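/- Let $n,n_c,m\ge 0$ and $d_c\ge 1$ be integers, and let $f:\mathbb R^n\to\mathbb R^n$, $g:\mathbb R^n\to\mathbb R^{n\times m}$, $f_c:\mathbb R^{n_c}\to\mathbb R^{n_c}$, $g_c:\mathbb R^{n_c}\to\mathbb R^{n_c\times m}$, $h_c:\mathbb R^{n_c}\to\mathbb R^m$, $c:\mathbb R^n\to\mathbb R^m$ and $Q:\mathbb R^n\to\mathbb R^{m\times m}$ be locally Lipschitz, with $Q(x)$ symmetric positive definite for every $x$. Put $$J(x,u)=\tfrac12 u^{T}Q(x)u+c(x)^{T}u,\qquad u_d(x,x_c)=-Q(x)^{-1}c(x).$$ Assume that $f,g,f_c$ are of class $C^{d_c-1}$ and that $h_c$ and $x\mapsto Q(x)^{-1}c(x)$ are of class $C^{d_c}$. For a differentiable map $\eta$ with Jacobian $\eta'$ write $L_\psi\eta=\eta'\psi$, and $L_\psi^{0}\eta=\eta$, $L_\psi^{i}\eta=L_\psi L_\psi^{i-1}\eta$ if $\psi$ is a vector field. Assume condition (C1): for all $x_c\in\mathbb R^{n_c}$, $L_{g_c}L_{f_c}^{i}h_c(x_c)=0$ for $0\le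 i\le d_c-2$, and the $m\times m$ matrix $L_{g_c}L_{f_c}^{d_c-1}h_c(x_c)$ is nonsingular. Let $\sigma_0,\dots,\sigma_{d_c-1}>0$ be such that all complex roots of $s^{d_c}+\sum_{i=0}^{d_c-1}\sigma_i s^{i}$ lie in the open left half-plane. With $\hat x=(x,x_c)$ and $\hat f(\hat x)=(f(x)+g(x)h_c(x_c),\,f_c(x_c))$, define the desired surrogate control $$\hat u_d(\hat x)=\bigl(L_{g_c}L_{f_c}^{d_c-1}h_c(x_c)\bigr)^{-1}\Bigl(L_{\hat f}^{d_c}u_d(\hat x)-L_{f_c}^{d_c}h_c(x_c)+\sum_{i=0}^{d_c-1}\sigma_i\bigl(L_{\hat f}^{i}u_d(\hat x)-L_{f_c}^{i}h_c(x_c)\bigr)\Bigr).$$ Consider solutions $\hat x=(x,x_c)$, on an interval $[0,T)$ with $0<T\le\infty$ and with $\hat x(0)=\hat x_0$, of the cascade $$\dot x=f(x)+g(x)u,\qquad \dot x_c=f_c(x_c)+g_c(x_c)\,\hat u_d(\hat x),\qquad u=h_c(x_c),$$ and put $e(t)=u(t)-u_d(\hat x(t))$. Then: (a) For every such solution, $e$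 is of class $C^{d_c}$ on $[0,T)$ and $e^{(d_c)}(t)+\sum_{i=0}^{d_c-1}\sigma_i e^{(i)}(t)=0$ for all $t\in[0,T)$. (b) There is $r>0$ such that for every $\hat x_0\in\mathbb R^n\times\mathbb R^{n_c}$ and every solution on some $[0,T)$ starting at $\hat x_0$ there is $K$ with $\|e(t)\|\le Ke^{-rt}$ for all $t\in[0,T)$; if $T=\infty$, then $\lim_{t\to\infty}e(t)=0$ (exponentially). (c) If $Q$ is bounded, then for every $\hat x_0$ and every solution on $[0,\infty)$ starting at $\hat x_0$, $\lim_{t\to\infty}\bigl[J(x(t),u(t))-J(x(t),u_d(\hat x(t)))\bigr]=0$. (d) If $\hat x_0=(x_0,x_{c0})$ satisfies $L_{f_c}^{i}h_c(x_{c0})=L_{\hat f}^{i}u_d(\hat x_0)$ for $i=0,\dots,d_c-1$, then every solution starting at $\hat x_0$ satisfies $u(t)=u_d(\hat x(t))$ for all $t\in[0,T)$. -/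

import Mathlib

open scoped Matrix Topology

namespace CascadeControl

noncomputable section

/-- The Jacobian matrix `η'(x)` of `η : ℝᵏ → ℝˡ`. -/
def jacobian {k l : ℕ} (η : (Fin k → ℝ) → (Fin l → ℝ)) (x : Fin k → ℝ) :
    Matrix (Fin l) (Fin k) ℝ :=
  LinearMap.toMatrix' (fderiv ℝ η x : (Fin k → ℝ) →ₗ[ℝ] (Fin l → ℝ))

/-- The Lie derivative `L_ψ η (x) = η'(x) ψ(x)` along a matrix-valued map `ψ : ℝᵏ → ℝ^{k × m}`. -/
def lieMat {k l m : ℕ} (ψ : (Fin k → ℝ) → Matrix (Fin k) (Fin m) ℝ)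
    (η : (Fin k → ℝ) → (Fin l → ℝ)) (x : Fin k → ℝ) : Matrix (Fin l) (Fin m) ℝ :=
  jacobian η x * ψ x

/-- The Lie derivative `L_ψ η (x) = η'(x) ψ(x)` along a vector field `ψ`.
The iterated Lie derivative `L_ψ^i η` is `(lieDeriv ψ)^[i] η`. -/
def lieDeriv {E F : Type*} [NormedAddCommGroup E] [NormedSpace ℝ E]
    [NormedAddCommGroup F] [NormedSpace ℝ F] (ψ : E → E) (η : E → F) : E → F :=
  fun x => fderiv ℝ η x (ψ x)

/-- The drift of the cascade, `f̂(x, x_c) = (f(x) + g(x) h_c(x_c), f_c(x_c))`. The cascade state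
`x̂ = (x, x_c)` is an element of `ℝⁿ × ℝ^{n_c}`. -/
def cascadeDrift {n nc m : ℕ} (f : (Fin n → ℝ) → (Fin n → ℝ))
    (g : (Fin n → ℝ) → Matrix (Fin n) (Fin m) ℝ)
    (fc : (Fin nc → ℝ) → (Fin nc → ℝ)) (hc : (Fin nc → ℝ) → (Fin m → ℝ)) :
    (Fin n → ℝ) × (Fin nc → ℝ) → (Fin n → ℝ) × (Fin nc → ℝ) :=
  fun p => (f p.1 + g p.1 *ᵥ hc p.2, fc p.2)

/-- The input term of the cascade, `ĝ(x, x_c) v = (0, g_c(x_c) v)`. -/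
def cascadeInput {n nc m : ℕ} (gc : (Fin nc → ℝ) → Matrix (Fin nc) (Fin m) ℝ)
    (p : (Fin n → ℝ) × (Fin nc → ℝ)) (v : Fin m → ℝ) : (Fin n → ℝ) × (Fin nc → ℝ) :=
  (0, gc p.2 *ᵥ v)

/-- `h_c` has relative degree `d_c ≥ 1` for the control dynamics: `L_{g_c} L_{f_c}^i h_c = 0` for
`i = 0, …, d_c - 2` and `L_{g_c} L_{f_c}^{d_c - 1} h_c` is nonsingular, everywhere. -/
def HasRelDegree {nc m : ℕ} (fc : (Fin nc → ℝ) → (Fin nc → ℝ))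
    (gc : (Fin nc → ℝ) → Matrix (Fin nc) (Fin m) ℝ) (hc : (Fin nc → ℝ) → (Fin m → ℝ))
    (dc : ℕ) : Prop :=
  0 < dc ∧
  (∀ (xc : Fin nc → ℝ) (i : ℕ), i + 2 ≤ dc → lieMat gc ((lieDeriv fc)^[i] hc) xc = 0) ∧
  (∀ xc : Fin nc → ℝ, IsUnit (lieMat gc ((lieDeriv fc)^[dc - 1] hc) xc))

/-- The cost `J(x, u) = ½ uᵀ Q(x) u + c(x)ᵀ u`. -/
def cost {n m : ℕ} (Q : (Fin n → ℝ) → Matrix (Fin m) (Fin m) ℝ)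
    (c : (Fin n → ℝ) → (Fin m → ℝ)) (x : Fin n → ℝ) (u : Fin m → ℝ) : ℝ :=
  1 / 2 * (u ⬝ᵥ (Q x *ᵥ u)) + c x ⬝ᵥ u

/-- The desired control `u_d(x̂) = -Q(x)⁻¹ c(x)`, as a function of `x̂ = (x, x_c)`. -/
def desiredControl {n nc m : ℕ} (Q : (Fin n → ℝ) → Matrix (Fin m) (Fin m) ℝ)
    (c : (Fin n → ℝ) → (Fin m → ℝ)) : (Fin n → ℝ) × (Fin nc → ℝ) → (Fin m → ℝ) :=
  fun p => -((Q p.1)⁻¹ *ᵥ c p.1)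

/-- The desired surrogate control `û_d`. -/
def desiredSurrogate {n nc m : ℕ} (f : (Fin n → ℝ) → (Fin n → ℝ))
    (g : (Fin n → ℝ) → Matrix (Fin n) (Fin m) ℝ)
    (fc : (Fin nc → ℝ) → (Fin nc → ℝ)) (gc : (Fin nc → ℝ) → Matrix (Fin nc) (Fin m) ℝ)
    (hc : (Fin nc → ℝ) → (Fin m → ℝ)) (Q : (Fin n → ℝ) → Matrix (Fin m) (Fin m) ℝ)
    (c : (Fin n → ℝ) → (Fin m → ℝ)) (dc : ℕ) (σ : Fin dc → ℝ) :
    (Fin n → ℝ) × (Fin nc → ℝ) → (Fin m → ℝ) :=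
  fun p =>
    (lieMat gc ((lieDeriv fc)^[dc - 1] hc) p.2)⁻¹ *ᵥ
      ((lieDeriv (cascadeDrift f g fc hc))^[dc] (desiredControl Q c) p
          - (lieDeriv fc)^[dc] hc p.2
        + ∑ i : Fin dc, σ i •
            ((lieDeriv (cascadeDrift f g fc hc))^[(i : ℕ)] (desiredControl Q c) p
              - (lieDeriv fc)^[(i : ℕ)] hc p.2))

/-- The time interval `[0, T)`, where `T = ⊤` gives `[0, ∞)`. -/
def timeInterval (T : EReal) : Set ℝ := {t : ℝ | 0 ≤ t ∧ (t : EReal) < T}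

/-- `X` solves the cascade `x̂' = f̂(x̂) + ĝ(x̂) û(x̂)`, `x̂(0) = x̂₀`, on `[0, T)`
(with the right derivative at `0`), where `0 < T ≤ ∞`. -/
def IsCascadeSolution {n nc m : ℕ} (f : (Fin n → ℝ) → (Fin n → ℝ))
    (g : (Fin n → ℝ) → Matrix (Fin n) (Fin m) ℝ)
    (fc : (Fin nc → ℝ) → (Fin nc → ℝ)) (gc : (Fin nc → ℝ) → Matrix (Fin nc) (Fin m) ℝ)
    (hc : (Fin nc → ℝ) → (Fin m → ℝ))
    (uhat : (Fin n → ℝ) × (Fin nc → ℝ) → (Fin m → ℝ))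
    (x₀ : (Fin n → ℝ) × (Fin nc → ℝ)) (T : EReal)
    (X : ℝ → (Fin n → ℝ) × (Fin nc → ℝ)) : Prop :=
  0 < T ∧ X 0 = x₀ ∧
  ∀ t ∈ timeInterval T,
    HasDerivWithinAt X (cascadeDrift f g fc hc (X t) + cascadeInput gc (X t) (uhat (X t)))
      (timeInterval T) t

/-- The error `e(t) = u(t) - u_d(x̂(t))` along a trajectory, with `u(t) = h_c(x_c(t))`. -/
def controlError {n nc m : ℕ} (hc : (Fin nc → ℝ) → (Fin m → ℝ))
    (Q : (Fin n → ℝ) → Matrix (Fin m) (Fin m) ℝ) (c : (Fin n → ℝ) → (Fin m → ℝ))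
    (X : ℝ → (Fin n → ℝ) × (Fin nc → ℝ)) (t : ℝ) : Fin m → ℝ :=
  hc (X t).2 - desiredControl Q c (X t)

end

end CascadeControl

/-! The error and its derivatives of order below `dc` along a solution are differences of Lie
derivatives of `hc` and of the desired control. The crux is that the input does not enter the
derivatives of the desired control up to order `dc`. Since that control depends on `x` alone, its
`k`-th Lie derivative depends only on `x` and the first `k` Lie derivatives of `hc`, of orders 0 to
`k - 1`; for `k < dc` condition (C1) keeps the input out of their derivatives. To prove this without
expanding Lie derivatives, `chainCoord` maps the cascade to a plant driven by integrators, where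
dependence on the first `k` integrators is invariance under `truncate`
(`iterate_lieDeriv_cascadeDrift`, `fderiv_iterate_lieDeriv_cascade`).

The input thus appears first in the `dc`-th derivative, through a nonsingular matrix, and the
surrogate control turns that derivative into the linear error equation
(`hasDerivWithinAt_errorJet`). Splitting the minimal polynomial of its companion operator into
linear factors gives `‖e(t)‖ ≤ C ‖jet(0)‖ exp(-r t)` with `r`, `C` independent of the solution. This
yields (b), and also (d), where the initial jet vanishes. For (c), the excess cost is quadratic in
the error. -/

namespace CascadeControl

/-! ### Regularity of iterated Lie derivatives -/

section LieDerivatives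

variable {E F : Type*} [NormedAddCommGroup E] [NormedSpace ℝ E]
  [NormedAddCommGroup F] [NormedSpace ℝ F]

/-- Each Lie derivative costs one order of smoothness, and the field, one order below `η`, is never
the bottleneck after the first step. -/
theorem contDiff_iterate_lieDeriv {ψ : E → E} {η : E → F} {d : ℕ}
    (hψ : ContDiff ℝ ((d - 1 : ℕ) : WithTop ℕ∞) ψ) (hη : ContDiff ℝ (d : WithTop ℕ∞) η)
    {i : ℕ} (hi : i ≤ d) :
    ContDiff ℝ ((d - i : ℕ) : WithTop ℕ∞) ((lieDeriv ψ)^[i] η) := by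
  induction i with
  | zero => simpa using hη
  | succ i ih =>
    rw [Function.iterate_succ_apply']
    have h := ih (by omega)
    have h1 : ContDiff ℝ ((d - (i + 1) : ℕ) : WithTop ℕ∞) (fderiv ℝ ((lieDeriv ψ)^[i] η)) := by
      refine h.fderiv_right ?_
      have : d - (i + 1) + 1 = d - i := by omega
      exact_mod_cast this.le
    refine h1.clm_apply (hψ.of_le ?_)
    have : d - (i + 1) ≤ d - 1 := by omega
    exact_mod_cast this

theorem differentiable_iterate_lieDeriv {ψ : E → E} {η : E → F} {d : ℕ}
    (hψ : ContDiff ℝ ((d - 1 : ℕ) : WithTop ℕ∞) ψ) (hη : ContDiff ℝ (d : WithTop ℕ∞) η)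
    {i : ℕ} (hi : i < d) : Differentiable ℝ ((lieDeriv ψ)^[i] η) := by
  refine (contDiff_iterate_lieDeriv hψ hη hi.le).differentiable ?_
  have : d - i ≠ 0 := by omega
  exact_mod_cast this

end LieDerivatives

theorem lieMat_mulVec {k l m : ℕ} (ψ : (Fin k → ℝ) → Matrix (Fin k) (Fin m) ℝ)
    (η : (Fin k → ℝ) → (Fin l → ℝ)) (x : Fin k → ℝ) (v : Fin m → ℝ) :
    lieMat ψ η x *ᵥ v = fderiv ℝ η x (ψ x *ᵥ v) := by
  rw [lieMat, jacobian, ← Matrix.mulVec_mulVec, LinearMap.toMatrix'_mulVec]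
  rfl

theorem contDiff_mulVec {E : Type*} [NormedAddCommGroup E] [NormedSpace ℝ E] {k l : ℕ}
    {N : WithTop ℕ∞} {A : E → Matrix (Fin k) (Fin l) ℝ} {v : E → Fin l → ℝ}
    (hA : ∀ i j, ContDiff ℝ N fun x => A x i j) (hv : ContDiff ℝ N v) :
    ContDiff ℝ N fun x => A x *ᵥ v x := by
  rw [contDiff_pi]
  intro i
  simp only [Matrix.mulVec, dotProduct]
  exact ContDiff.sum fun j _ => (hA i j).mul (contDiff_pi.1 hv j)

/-! ### The plant driven by a chain of integrators -/

section Chain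

variable {n m d : ℕ}

/-- The `k`-th entry of `ξ`, and `0` beyond its length. -/
def entry {V : Type*} [Zero V] (ξ : Fin d → V) (k : ℕ) : V :=
  if h : k < d then ξ ⟨k, h⟩ else 0

theorem entry_of_lt {V : Type*} [Zero V] (ξ : Fin d → V) {k : ℕ} (h : k < d) :
    entry ξ k = ξ ⟨k, h⟩ := dif_pos h

theorem contDiff_entry {V : Type*} [NormedAddCommGroup V] [NormedSpace ℝ V] {N : WithTop ℕ∞}
    (k : ℕ) : ContDiff ℝ N fun ξ : Fin d → V => entry ξ k := by
  unfold entry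
  split_ifs with h
  · exact contDiff_apply ℝ V _
  · exact contDiff_const

/-- The vector field of the plant driven by a chain of `d` integrators. -/
def chainField (f : (Fin n → ℝ) → (Fin n → ℝ)) (g : (Fin n → ℝ) → Matrix (Fin n) (Fin m) ℝ)
    (q : (Fin n → ℝ) × (Fin d → Fin m → ℝ)) : (Fin n → ℝ) × (Fin d → Fin m → ℝ) :=
  (f q.1 + g q.1 *ᵥ entry q.2 0, fun j => entry q.2 (j + 1))

theorem contDiff_chainField {N : WithTop ℕ∞} {f : (Fin n → ℝ) → (Fin n → ℝ)}
    {g : (Fin n → ℝ) → Matrix (Fin n) (Fin m) ℝ} (hf : ContDiff ℝ N f)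
    (hg : ∀ i j, ContDiff ℝ N fun x => g x i j) :
    ContDiff ℝ N (chainField (d := d) f g) := by
  refine ContDiff.prodMk ?_ ?_
  · exact (hf.comp contDiff_fst).add
      (contDiff_mulVec (fun i j => (hg i j).comp contDiff_fst) ((contDiff_entry 0).comp contDiff_snd))
  · exact contDiff_pi.2 fun j => (contDiff_entry _).comp contDiff_snd

/-- The projection that keeps the plant state and the first `k` integrators. -/
noncomputable def truncate (n m d k : ℕ) :
    ((Fin n → ℝ) × (Fin d → Fin m → ℝ)) →L[ℝ] ((Fin n → ℝ) × (Fin d → Fin m → ℝ)) :=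
  (ContinuousLinearMap.fst ℝ _ _).prod
    (ContinuousLinearMap.pi fun j : Fin d =>
      if (j : ℕ) < k then (ContinuousLinearMap.proj j).comp (ContinuousLinearMap.snd ℝ _ _) else 0)

theorem truncate_apply (k : ℕ) (q : (Fin n → ℝ) × (Fin d → Fin m → ℝ)) :
    truncate n m d k q = (q.1, fun j : Fin d => if (j : ℕ) < k then q.2 j else 0) := by
  refine Prod.ext rfl (funext fun j => ?_)
  simp only [truncate, ContinuousLinearMap.prod_apply, ContinuousLinearMap.pi_apply]
  split_ifs <;> simp

theorem truncate_eq_truncate {k : ℕ} {q w : (Fin n → ℝ) × (Fin d → Fin m → ℝ)}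
    (h1 : q.1 = w.1) (h2 : ∀ j : Fin d, (j : ℕ) < k → Prod.snd q j = Prod.snd w j) :
    truncate n m d k q = truncate n m d k w := by
  rw [truncate_apply, truncate_apply, h1]
  refine Prod.ext rfl (funext fun j => ?_)
  dsimp only
  split_ifs with h
  · exact h2 j h
  · rfl

theorem truncate_succ (k : ℕ) (q : (Fin n → ℝ) × (Fin d → Fin m → ℝ)) :
    truncate n m d k (truncate n m d (k + 1) q) = truncate n m d k q := by
  refine truncate_eq_truncate ?_ fun j hj => ?_
  · rw [truncate_apply]
  · rw [truncate_apply]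
    exact if_pos (by omega)

/-- Integrator `j` is driven by integrator `j + 1`, so the first `k` components of the field see at
most the first `k + 1` integrators; the plant needs only integrator 0, which `k + 1` also covers
when `k = 0`. -/
theorem truncate_chainField_truncate (f : (Fin n → ℝ) → (Fin n → ℝ))
    (g : (Fin n → ℝ) → Matrix (Fin n) (Fin m) ℝ) (k : ℕ)
    (q : (Fin n → ℝ) × (Fin d → Fin m → ℝ)) :
    truncate n m d k (chainField f g (truncate n m d (k + 1) q))
      = truncate n m d k (chainField f g q) := by
  have key : ∀ j, j ≤ k → entry (truncate n m d (k + 1) q).2 j = entry q.2 j := by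
    intro j hj
    rw [truncate_apply]
    unfold entry
    split_ifs with h
    · exact if_pos (by simp only; omega)
    · rfl
  refine truncate_eq_truncate ?_ fun j hj => ?_
  · simp only [chainField]
    rw [key 0 (by omega), truncate_apply]
  · exact key _ (by omega)

variable {f : (Fin n → ℝ) → (Fin n → ℝ)} {g : (Fin n → ℝ) → Matrix (Fin n) (Fin m) ℝ}
  {F : Type*} [NormedAddCommGroup F] [NormedSpace ℝ F]

/-- Chain rule for `Φ = Φ ∘ truncate`, the truncation being its own derivative. -/
theorem fderiv_eq_of_comp_truncate {k : ℕ} {Φ : (Fin n → ℝ) × (Fin d → Fin m → ℝ) → F}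
    (hΦ : Differentiable ℝ Φ) (h : ∀ q, Φ (truncate n m d k q) = Φ q)
    (q w : (Fin n → ℝ) × (Fin d → Fin m → ℝ)) :
    fderiv ℝ Φ q w = fderiv ℝ Φ (truncate n m d k q) (truncate n m d k w) := by
  have h1 : HasFDerivAt Φ ((fderiv ℝ Φ (truncate n m d k q)).comp (truncate n m d k)) q := by
    have := (hΦ (truncate n m d k q)).hasFDerivAt.comp q (truncate n m d k).hasFDerivAt
    have h2 : Φ ∘ (truncate n m d k) = Φ := funext h
    rwa [h2] at this
  rw [h1.fderiv]
  rfl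

theorem differentiable_iterate_lieDeriv_chainField
    (hf : ContDiff ℝ ((d - 1 : ℕ) : WithTop ℕ∞) f)
    (hg : ∀ i j, ContDiff ℝ ((d - 1 : ℕ) : WithTop ℕ∞) fun x => g x i j)
    {η : (Fin n → ℝ) → F} (hη : ContDiff ℝ (d : WithTop ℕ∞) η) {k : ℕ} (hk : k < d) :
    Differentiable ℝ ((lieDeriv (chainField (d := d) f g))^[k] fun q => η q.1) :=
  differentiable_iterate_lieDeriv (contDiff_chainField hf hg) (hη.comp contDiff_fst) hk

/-- `k` Lie derivatives of a function of the plant state involve only the first `k` integrators. -/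
theorem iterate_lieDeriv_chainField_truncate
    (hf : ContDiff ℝ ((d - 1 : ℕ) : WithTop ℕ∞) f)
    (hg : ∀ i j, ContDiff ℝ ((d - 1 : ℕ) : WithTop ℕ∞) fun x => g x i j)
    {η : (Fin n → ℝ) → F} (hη : ContDiff ℝ (d : WithTop ℕ∞) η) {k : ℕ} (hk : k ≤ d)
    (q : (Fin n → ℝ) × (Fin d → Fin m → ℝ)) :
    (lieDeriv (chainField f g))^[k] (fun q => η q.1) (truncate n m d k q)
      = (lieDeriv (chainField f g))^[k] (fun q => η q.1) q := by
  induction k generalizing q with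
  | zero => simp only [Function.iterate_zero, id, truncate_apply]
  | succ k ih =>
    have hd := differentiable_iterate_lieDeriv_chainField (m := m) hf hg hη (Nat.lt_of_succ_le hk)
    have ih := ih (by omega)
    rw [Function.iterate_succ_apply']
    change fderiv ℝ _ _ _ = fderiv ℝ _ _ _
    rw [fderiv_eq_of_comp_truncate hd ih, truncate_succ, truncate_chainField_truncate]
    exact (fderiv_eq_of_comp_truncate hd ih _ _).symm

/-- The derivative ignores the integrators from index `k` on, so a direction agreeing with the field
up to truncation is as good as the field itself. This absorbs both the input and the artificial zero
that ends the chain. -/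
theorem fderiv_iterate_lieDeriv_chainField
    (hf : ContDiff ℝ ((d - 1 : ℕ) : WithTop ℕ∞) f)
    (hg : ∀ i j, ContDiff ℝ ((d - 1 : ℕ) : WithTop ℕ∞) fun x => g x i j)
    {η : (Fin n → ℝ) → F} (hη : ContDiff ℝ (d : WithTop ℕ∞) η) {k : ℕ} (hk : k < d)
    {q w : (Fin n → ℝ) × (Fin d → Fin m → ℝ)}
    (hw : truncate n m d k w = truncate n m d k (chainField f g q)) :
    fderiv ℝ ((lieDeriv (chainField f g))^[k] (fun q => η q.1)) q w
      = (lieDeriv (chainField f g))^[k + 1] (fun q => η q.1) q := by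
  have hd := differentiable_iterate_lieDeriv_chainField (m := m) hf hg hη hk
  have h := iterate_lieDeriv_chainField_truncate hf hg hη hk.le
  rw [Function.iterate_succ_apply']
  change _ = fderiv ℝ _ _ _
  rw [fderiv_eq_of_comp_truncate hd h, hw]
  exact (fderiv_eq_of_comp_truncate hd h _ _).symm

end Chain

/-! ### Transfer from the integrator chain to the cascade -/

section Cascade

variable {n nc m d : ℕ} {f : (Fin n → ℝ) → (Fin n → ℝ)}
  {g : (Fin n → ℝ) → Matrix (Fin n) (Fin m) ℝ} {fc : (Fin nc → ℝ) → (Fin nc → ℝ)}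
  {gc : (Fin nc → ℝ) → Matrix (Fin nc) (Fin m) ℝ} {hc : (Fin nc → ℝ) → (Fin m → ℝ)}
  {F : Type*} [NormedAddCommGroup F] [NormedSpace ℝ F]

/-- The plant state together with the first `d` Lie derivatives of the output `hc`. -/
noncomputable def chainCoord (fc : (Fin nc → ℝ) → (Fin nc → ℝ)) (hc : (Fin nc → ℝ) → (Fin m → ℝ)) (d : ℕ)
    (p : (Fin n → ℝ) × (Fin nc → ℝ)) : (Fin n → ℝ) × (Fin d → Fin m → ℝ) :=
  (p.1, fun j => (lieDeriv fc)^[(j : ℕ)] hc p.2)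

theorem hasFDerivAt_chainCoord (hfc : ContDiff ℝ ((d - 1 : ℕ) : WithTop ℕ∞) fc)
    (hhc : ContDiff ℝ (d : WithTop ℕ∞) hc) (p : (Fin n → ℝ) × (Fin nc → ℝ)) :
    HasFDerivAt (chainCoord (n := n) fc hc d)
      ((ContinuousLinearMap.fst ℝ (Fin n → ℝ) (Fin nc → ℝ)).prod
        (ContinuousLinearMap.pi fun j : Fin d =>
          (fderiv ℝ ((lieDeriv fc)^[(j : ℕ)] hc) p.2).comp (ContinuousLinearMap.snd ℝ _ _))) p := by
  refine hasFDerivAt_fst.prodMk (hasFDerivAt_pi.2 fun j => ?_)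
  exact ((differentiable_iterate_lieDeriv hfc hhc j.2) p.2).hasFDerivAt.comp p hasFDerivAt_snd

theorem fderiv_iterate_lieDeriv_output {k : ℕ} (xc : Fin nc → ℝ) (w : Fin m → ℝ) :
    fderiv ℝ ((lieDeriv fc)^[k] hc) xc (fc xc + gc xc *ᵥ w)
      = (lieDeriv fc)^[k + 1] hc xc + lieMat gc ((lieDeriv fc)^[k] hc) xc *ᵥ w := by
  rw [map_add, lieMat_mulVec, Function.iterate_succ_apply']
  rfl

/-- Here the relative degree enters: for `j < k < d` one has `j + 2 ≤ d`, so the input term of the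
derivative of coordinate `j` vanishes, and the next coordinate is still inside the chain. -/
theorem truncate_fderiv_chainCoord (hfc : ContDiff ℝ ((d - 1 : ℕ) : WithTop ℕ∞) fc)
    (hhc : ContDiff ℝ (d : WithTop ℕ∞) hc) (hrel : HasRelDegree fc gc hc d)
    {k : ℕ} (hk : k < d) (p : (Fin n → ℝ) × (Fin nc → ℝ)) (w : Fin m → ℝ) :
    truncate n m d k (fderiv ℝ (chainCoord (n := n) fc hc d) p
        (cascadeDrift f g fc hc p + cascadeInput gc p w))
      = truncate n m d k (chainField f g (chainCoord fc hc d p)) := by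
  rw [(hasFDerivAt_chainCoord hfc hhc p).fderiv]
  refine truncate_eq_truncate ?_ fun j hj => ?_
  · simp [cascadeDrift, cascadeInput, chainField, chainCoord, entry_of_lt _ hrel.1]
  · have hj' : (j : ℕ) + 1 < d := by omega
    change fderiv ℝ _ p.2 (fc p.2 + gc p.2 *ᵥ w) = entry _ _
    rw [fderiv_iterate_lieDeriv_output, hrel.2.1 p.2 j (by omega), Matrix.zero_mulVec, add_zero,
      entry_of_lt _ hj']
    rfl

/-- `chainCoord` need not conjugate the two fields exactly, since they may differ in the last
coordinate; agreement up to truncation `k` suffices for the `k + 1`-st Lie derivative. -/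
theorem iterate_lieDeriv_cascadeDrift (hf : ContDiff ℝ ((d - 1 : ℕ) : WithTop ℕ∞) f)
    (hg : ∀ i j, ContDiff ℝ ((d - 1 : ℕ) : WithTop ℕ∞) fun x => g x i j)
    (hfc : ContDiff ℝ ((d - 1 : ℕ) : WithTop ℕ∞) fc)
    (hhc : ContDiff ℝ (d : WithTop ℕ∞) hc) (hrel : HasRelDegree fc gc hc d)
    {η : (Fin n → ℝ) → F} (hη : ContDiff ℝ (d : WithTop ℕ∞) η) {k : ℕ} (hk : k ≤ d) :
    (lieDeriv (cascadeDrift f g fc hc))^[k] (fun p => η p.1)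
      = (lieDeriv (chainField f g))^[k] (fun q => η q.1) ∘ chainCoord fc hc d := by
  induction k with
  | zero => rfl
  | succ k ih =>
    have hd := differentiable_iterate_lieDeriv_chainField (m := m) hf hg hη (Nat.lt_of_succ_le hk)
    rw [Function.iterate_succ_apply', ih (by omega)]
    funext p
    change fderiv ℝ _ p _ = _
    rw [fderiv_comp p (hd _) (hasFDerivAt_chainCoord hfc hhc p).differentiableAt]
    refine fderiv_iterate_lieDeriv_chainField hf hg hη (Nat.lt_of_succ_le hk) ?_
    -- The drift alone is the case of zero input.
    have := truncate_fderiv_chainCoord (f := f) (g := g) hfc hhc hrel (Nat.lt_of_succ_le hk) p 0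
    simpa [cascadeInput, ← Prod.zero_eq_mk] using this

/-- The input does not enter the first `d` derivatives of a function of the plant state. -/
theorem fderiv_iterate_lieDeriv_cascade (hf : ContDiff ℝ ((d - 1 : ℕ) : WithTop ℕ∞) f)
    (hg : ∀ i j, ContDiff ℝ ((d - 1 : ℕ) : WithTop ℕ∞) fun x => g x i j)
    (hfc : ContDiff ℝ ((d - 1 : ℕ) : WithTop ℕ∞) fc)
    (hhc : ContDiff ℝ (d : WithTop ℕ∞) hc) (hrel : HasRelDegree fc gc hc d)
    {η : (Fin n → ℝ) → F} (hη : ContDiff ℝ (d : WithTop ℕ∞) η) {k : ℕ} (hk : k < d)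
    (p : (Fin n → ℝ) × (Fin nc → ℝ)) (w : Fin m → ℝ) :
    HasFDerivAt ((lieDeriv (cascadeDrift f g fc hc))^[k] (fun p => η p.1))
        (fderiv ℝ ((lieDeriv (cascadeDrift f g fc hc))^[k] (fun p => η p.1)) p) p ∧
      fderiv ℝ ((lieDeriv (cascadeDrift f g fc hc))^[k] (fun p => η p.1)) p
        (cascadeDrift f g fc hc p + cascadeInput gc p w)
      = (lieDeriv (cascadeDrift f g fc hc))^[k + 1] (fun p => η p.1) p := by
  have hd := differentiable_iterate_lieDeriv_chainField (m := m) hf hg hη hk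
  have hz := (hasFDerivAt_chainCoord (n := n) hfc hhc p).differentiableAt
  rw [iterate_lieDeriv_cascadeDrift hf hg hfc hhc hrel hη hk.le,
    iterate_lieDeriv_cascadeDrift hf hg hfc hhc hrel hη (Nat.succ_le_of_lt hk)]
  refine ⟨((hd _).comp p hz).hasFDerivAt, ?_⟩
  rw [fderiv_comp p (hd _) hz]
  exact fderiv_iterate_lieDeriv_chainField hf hg hη hk
    (truncate_fderiv_chainCoord hfc hhc hrel hk p w)

end Cascade

end CascadeControl
namespace CascadeControl

/-! ### Half-open time intervals -/

section TimeInterval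

theorem Icc_subset_timeInterval {T : EReal} {t : ℝ} (ht : t ∈ timeInterval T) :
    Set.Icc 0 t ⊆ timeInterval T := fun _ hs =>
  ⟨hs.1, lt_of_le_of_lt (EReal.coe_le_coe_iff.2 hs.2) ht.2⟩

theorem exists_gt_mem_timeInterval {T : EReal} {t : ℝ} (ht : t ∈ timeInterval T) :
    ∃ s ∈ timeInterval T, t < s := by
  obtain ⟨s, hs1, hs2⟩ := EReal.lt_iff_exists_real_btwn.1 ht.2
  have h : t < s := EReal.coe_lt_coe_iff.1 hs1
  exact ⟨s, ⟨ht.1.trans h.le, hs2⟩, h⟩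

theorem zero_mem_timeInterval {T : EReal} (hT : 0 < T) : (0 : ℝ) ∈ timeInterval T :=
  ⟨le_rfl, by simpa using hT⟩

theorem uniqueDiffOn_timeInterval {T : EReal} (hT : 0 < T) :
    UniqueDiffOn ℝ (timeInterval T) := by
  have hord : (timeInterval T).OrdConnected :=
    ⟨fun a ha b hb s hs => ⟨ha.1.trans hs.1, lt_of_le_of_lt (EReal.coe_le_coe_iff.2 hs.2) hb.2⟩⟩
  refine uniqueDiffOn_convex hord.convex ?_
  obtain ⟨s, hs, hs0⟩ := exists_gt_mem_timeInterval (zero_mem_timeInterval hT)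
  refine ⟨s / 2, interior_mono (Icc_subset_timeInterval hs) ?_⟩
  rw [interior_Icc]
  constructor <;> linarith

end TimeInterval

/-! ### Exponential decay for linear systems -/

section Decay

variable {V : Type*} [NormedAddCommGroup V] [NormedSpace ℂ V]

/-- Variation of constants: with the integrating factor `exp(-a t)`, the derivative has norm at most
`K exp(δ t)`, `δ = -Re a - r > 0`. A differential inequality replaces the integral. -/
theorem norm_le_of_hasDerivWithinAt_smul_add {a : ℂ} {r K : ℝ} (ha : a.re < -r) (hK : 0 ≤ K)
    {T : EReal} {Y Z : ℝ → V}
    (hY : ∀ t ∈ timeInterval T, HasDerivWithinAt Y (a • Y t + Z t) (timeInterval T) t)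
    (hZ : ∀ t ∈ timeInterval T, ‖Z t‖ ≤ K * Real.exp (-r * t))
    {t : ℝ} (ht : t ∈ timeInterval T) :
    ‖Y t‖ ≤ (‖Y 0‖ + K / (-a.re - r)) * Real.exp (-r * t) := by
  set δ := -a.re - r with hδ
  have hδ0 : 0 < δ := by linarith
  have hexp : ∀ s : ℝ, HasDerivAt (fun s : ℝ => Complex.exp (-a * s)) (-a * Complex.exp (-a * s)) s := by
    intro s
    have h1 : HasDerivAt (fun s : ℝ => -a * (s : ℂ)) (-a) s := by
      simpa using (Complex.ofRealCLM.hasDerivAt (x := s)).const_mul (-a)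
    simpa [mul_comm] using h1.cexp
  have hnorm : ∀ s : ℝ, ‖Complex.exp (-a * s)‖ = Real.exp (-a.re * s) := by
    intro s
    rw [Complex.norm_exp]
    simp
  set G : ℝ → V := fun s => Complex.exp (-a * s) • Y s with hG
  have hGd : ∀ s ∈ timeInterval T,
      HasDerivWithinAt G (Complex.exp (-a * s) • Z s) (timeInterval T) s := by
    intro s hs
    have := (hexp s).hasDerivWithinAt.smul (hY s hs)
    refine this.congr_deriv ?_
    module
  -- The comparison function drops the term `-K / δ` of the exact integral, which only weakens the
  -- bound.
  have hB : ∀ s, HasDerivAt (fun s => ‖Y 0‖ + K / δ * Real.exp (δ * s))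
      (K * Real.exp (δ * s)) s := by
    intro s
    have h1 : HasDerivAt (fun s => δ * s) δ s := by simpa using (hasDerivAt_id s).const_mul δ
    refine ((h1.exp.const_mul (K / δ)).const_add ‖Y 0‖).congr_deriv ?_
    field_simp
  have hsub := Icc_subset_timeInterval ht
  have hGt : ‖G t‖ ≤ ‖Y 0‖ + K / δ * Real.exp (δ * t) := by
    refine image_norm_le_of_norm_deriv_right_le_deriv_boundary (a := 0) (b := t)
      (f := G) (f' := fun s => Complex.exp (-a * s) • Z s)
      (fun s hs => ((hGd s (hsub hs)).mono hsub).continuousWithinAt) (fun s hs => ?_) ?_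
      hB (fun s hs => ?_) ⟨ht.1, le_rfl⟩
    · have hsI : s ∈ Set.Icc 0 t := ⟨hs.1, hs.2.le⟩
      refine ((hGd s (hsub hsI)).mono hsub).mono_of_mem_nhdsWithin ?_
      exact Filter.mem_of_superset (Icc_mem_nhdsGE hs.2) (Set.Icc_subset_Icc_left hs.1)
    · simp only [hG]
      simp
      positivity
    · have hsI : s ∈ Set.Icc 0 t := ⟨hs.1, hs.2.le⟩
      rw [norm_smul, hnorm]
      calc Real.exp (-a.re * s) * ‖Z s‖ ≤ Real.exp (-a.re * s) * (K * Real.exp (-r * s)) := by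
            gcongr
            exact hZ s (hsub hsI)
        _ = K * Real.exp (δ * s) := by
            rw [mul_left_comm, ← Real.exp_add]
            congr 2
            rw [hδ]
            ring
  have hYG : ‖Y t‖ = Real.exp (a.re * t) * ‖G t‖ := by
    simp only [hG]
    rw [norm_smul, hnorm, ← mul_assoc, ← Real.exp_add]
    simp
  have h1 : Real.exp (a.re * t) ≤ Real.exp (-r * t) :=
    Real.exp_le_exp.2 (mul_le_mul_of_nonneg_right ha.le ht.1)
  have h2 : Real.exp (a.re * t) * Real.exp (δ * t) = Real.exp (-r * t) := by
    rw [← Real.exp_add]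
    congr 1
    rw [hδ]
    ring
  calc ‖Y t‖ ≤ Real.exp (a.re * t) * (‖Y 0‖ + K / δ * Real.exp (δ * t)) := by
        rw [hYG]
        gcongr
    _ = Real.exp (a.re * t) * ‖Y 0‖ + K / δ * Real.exp (-r * t) := by
        rw [← h2]
        ring
    _ ≤ Real.exp (-r * t) * ‖Y 0‖ + K / δ * Real.exp (-r * t) := by gcongr
    _ = _ := by ring

/-- Peel off one root at a time: `(A - a) Y` solves the same equation and is annihilated by the
remaining factors, hence decays, and it is the forcing term in `Y' = a Y + (A - a) Y`. Keeping all
roots strictly left of `-r` avoids polynomial factors for repeated roots. -/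
theorem exists_norm_le_of_aeval_prod (A : V →L[ℂ] V) {r : ℝ} (s : Multiset ℂ)
    (hs : ∀ a ∈ s, a.re < -r) :
    ∃ C : ℝ, 0 ≤ C ∧ ∀ (T : EReal) (Y : ℝ → V), 0 < T →
      (∀ t ∈ timeInterval T, HasDerivWithinAt Y (A (Y t)) (timeInterval T) t) →
      (∀ t ∈ timeInterval T, Polynomial.aeval A (s.map fun a => Polynomial.X - Polynomial.C a).prod (Y t) = 0) →
      ∀ t ∈ timeInterval T, ‖Y t‖ ≤ C * ‖Y 0‖ * Real.exp (-r * t) := by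
  induction s using Multiset.induction_on with
  | empty =>
    refine ⟨0, le_rfl, fun T Y _ _ h t ht => ?_⟩
    have : Y t = 0 := by simpa using h t ht
    simp [this]
  | cons a s ih =>
    obtain ⟨C₀, hC₀, ih⟩ := ih fun b hb => hs b (Multiset.mem_cons_of_mem hb)
    have ha := hs a (Multiset.mem_cons_self a s)
    set B : V →L[ℂ] V := A - algebraMap ℂ (V →L[ℂ] V) a with hBdef
    have hBapp : ∀ v, B v = A v - a • v := fun v => by
      simp [hBdef, Algebra.algebraMap_eq_smul_one]
    have hδ : 0 < -a.re - r := by linarith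
    refine ⟨1 + C₀ * ‖B‖ / (-a.re - r), by positivity, fun T Y hT hY h t ht => ?_⟩
    have hZ : ∀ t ∈ timeInterval T, ‖B (Y t)‖ ≤ C₀ * ‖B (Y 0)‖ * Real.exp (-r * t) := by
      refine ih T (fun t => B (Y t)) hT (fun t ht => ?_) fun t ht => ?_
      · have h1 := (B.restrictScalars ℝ).hasFDerivAt.comp_hasDerivWithinAt t (hY t ht)
        refine h1.congr_deriv ?_
        change B (A (Y t)) = A (B (Y t))
        simp [hBapp]
      · have h1 := h t ht
        -- The factors commute; this order makes `A - a` act first.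
        rw [Multiset.map_cons, Multiset.prod_cons, mul_comm, map_mul] at h1
        simpa [hBdef] using h1
    have h2 := norm_le_of_hasDerivWithinAt_smul_add (K := C₀ * ‖B (Y 0)‖) ha (by positivity)
      (Z := fun t => B (Y t)) (fun t ht => (hY t ht).congr_deriv (by simp [hBapp])) hZ ht
    refine h2.trans ?_
    gcongr
    have h3 : C₀ * ‖B (Y 0)‖ / (-a.re - r) ≤ C₀ * (‖B‖ * ‖Y 0‖) / (-a.re - r) := by
      gcongr
      exact B.le_opNorm _
    calc _ ≤ ‖Y 0‖ + C₀ * (‖B‖ * ‖Y 0‖) / (-a.re - r) := by gcongr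
      _ = _ := by ring

/-- A linear system all of whose eigenvalues have negative real part is exponentially stable. -/
theorem exists_exponential_bound [FiniteDimensional ℂ V] (A : V →ₗ[ℂ] V)
    (hA : ∀ a, Module.End.HasEigenvalue A a → a.re < 0) :
    ∃ r C : ℝ, 0 < r ∧ ∀ (T : EReal) (Y : ℝ → V), 0 < T →
      (∀ t ∈ timeInterval T, HasDerivWithinAt Y (A (Y t)) (timeInterval T) t) →
      ∀ t ∈ timeInterval T, ‖Y t‖ ≤ C * ‖Y 0‖ * Real.exp (-r * t) := by
  have hmonic := minpoly.monic (Algebra.IsIntegral.isIntegral (R := ℂ) A)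
  set s := (minpoly ℂ A).roots with hs
  have hre : ∀ a ∈ s, a.re < 0 := fun a ha =>
    hA a (Module.End.hasEigenvalue_of_isRoot (Polynomial.isRoot_of_mem_roots ha))
  obtain ⟨r, hr, hr'⟩ : ∃ r : ℝ, 0 < r ∧ ∀ a ∈ s, a.re < -r := by
    -- Finitely many negative real parts leave a gap; the induction needs an arbitrary multiset.
    clear_value s
    clear hs
    induction s using Multiset.induction_on with
    | empty => exact ⟨1, one_pos, by simp⟩
    | cons a s ih =>
      obtain ⟨r, hr, h⟩ := ih fun b hb => hre b (Multiset.mem_cons_of_mem hb)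
      have ha := hre a (Multiset.mem_cons_self a s)
      refine ⟨min r (-a.re / 2), lt_min hr (by linarith), fun b hb => ?_⟩
      rcases Multiset.mem_cons.1 hb with rfl | hb
      · have := min_le_right r (-b.re / 2)
        linarith
      · have := min_le_left r (-a.re / 2)
        linarith [h b hb]
  obtain ⟨C, -, hC⟩ := exists_norm_le_of_aeval_prod (LinearMap.toContinuousLinearMap A) s hr'
  refine ⟨r, C, hr, fun T Y hT hY => hC T Y hT hY fun t _ => ?_⟩
  have hprod : (s.map fun a => Polynomial.X - Polynomial.C a).prod = minpoly ℂ A :=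
    ((IsAlgClosed.splits (minpoly ℂ A)).eq_prod_roots_of_monic hmonic).symm
  have hcomm : ∀ p : Polynomial ℂ, ∀ v : V,
      Polynomial.aeval (LinearMap.toContinuousLinearMap A) p v = Polynomial.aeval A p v := by
    intro p
    induction p using Polynomial.induction_on' with
    | add p q hp hq => intro v; simp [hp, hq]
    | monomial k b =>
      intro v
      have : ∀ v : V, ((LinearMap.toContinuousLinearMap A) ^ k) v = (A ^ k) v := by
        induction k with
        | zero => intro v; simp
        | succ k ih => intro v; simp [pow_succ, ih]
      simp [Polynomial.aeval_monomial, Algebra.algebraMap_eq_smul_one, this]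
  rw [hprod, hcomm, minpoly.aeval]
  rfl

end Decay

/-! ### The companion system of the error equation -/

section Companion

variable {d m : ℕ}

/-- The first-order system equivalent to `y^{(d)} + ∑ σ i • y^{(i)} = 0`. -/
noncomputable def companion (m : ℕ) (σ : Fin d → ℝ) : (Fin d → Fin m → ℂ) →ₗ[ℂ] (Fin d → Fin m → ℂ) :=
  LinearMap.pi fun i =>
    if h : (i : ℕ) + 1 < d then LinearMap.proj (⟨i + 1, h⟩ : Fin d)
    else -∑ j : Fin d, (σ j : ℂ) • LinearMap.proj (R := ℂ) (φ := fun _ => Fin m → ℂ) j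

theorem companion_apply_of_lt (σ : Fin d → ℝ) (v : Fin d → Fin m → ℂ) {i : Fin d}
    (h : (i : ℕ) + 1 < d) : companion m σ v i = v ⟨i + 1, h⟩ := by
  simp [companion, h]

theorem companion_apply_of_not_lt (σ : Fin d → ℝ) (v : Fin d → Fin m → ℂ) {i : Fin d}
    (h : ¬(i : ℕ) + 1 < d) : companion m σ v i = -∑ j, (σ j : ℂ) • v j := by
  simp [companion, h]

/-- The upper rows force an eigenvector to be `v k = a ^ k • v 0` with `v 0 ≠ 0`; the last row is
then the characteristic equation times `v 0`. -/
theorem companion_eigenvalue (hd : 0 < d) {σ : Fin d → ℝ} {a : ℂ}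
    (ha : Module.End.HasEigenvalue (companion m σ) a) :
    a ^ d + ∑ i : Fin d, (σ i : ℂ) * a ^ (i : ℕ) = 0 := by
  obtain ⟨v, hv⟩ := ha.exists_hasEigenvector
  have hv1 : companion m σ v = a • v := hv.apply_eq_smul
  have hpow : ∀ k (hk : k < d), v ⟨k, hk⟩ = a ^ k • v ⟨0, hd⟩ := by
    intro k
    induction k with
    | zero => intro _; simp
    | succ k ih =>
      intro hk
      have := congrFun hv1 ⟨k, by omega⟩
      rw [companion_apply_of_lt σ v (i := ⟨k, by omega⟩) hk, Pi.smul_apply, ih] at this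
      rw [this, smul_smul, pow_succ']
  have hv0 : v ⟨0, hd⟩ ≠ 0 := by
    intro h0
    refine hv.2 (funext fun i => ?_)
    rw [hpow i i.2, h0, smul_zero, Pi.zero_apply]
  have hlast := congrFun hv1 ⟨d - 1, by omega⟩
  rw [companion_apply_of_not_lt σ v (i := ⟨d - 1, by omega⟩) (by simp only; omega), Pi.smul_apply,
    hpow (d - 1), smul_smul, ← pow_succ', Nat.sub_add_cancel hd] at hlast
  have hsum : ∑ j, (σ j : ℂ) • v j = (∑ j : Fin d, (σ j : ℂ) * a ^ (j : ℕ)) • v ⟨0, hd⟩ := by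
    rw [Finset.sum_smul]
    refine Finset.sum_congr rfl fun j _ => ?_
    rw [mul_smul, ← hpow j j.2]
  rw [hsum] at hlast
  have : (a ^ d + ∑ i : Fin d, (σ i : ℂ) * a ^ (i : ℕ)) • v ⟨0, hd⟩ = 0 := by
    rw [add_smul, ← hlast]
    simp
  exact (smul_eq_zero.1 this).resolve_right hv0

/-- Decay of the solutions of `y^{(d)} + ∑ σ i • y^{(i)} = 0` with a Hurwitz polynomial,
in terms of the derivatives `y 0, …, y (d - 1)`. -/
theorem exists_exponential_bound_of_hurwitz (m : ℕ) (hd : 0 < d) {σ : Fin d → ℝ}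
    (hσ : ∀ s : ℂ, s ^ d + ∑ i : Fin d, (σ i : ℂ) * s ^ (i : ℕ) = 0 → s.re < 0) :
    ∃ r C : ℝ, 0 < r ∧ ∀ (T : EReal) (y : ℕ → ℝ → Fin m → ℝ), 0 < T →
      (∀ i < d, ∀ t ∈ timeInterval T,
        HasDerivWithinAt (y i) (y (i + 1) t) (timeInterval T) t) →
      (∀ t ∈ timeInterval T, y d t + ∑ i : Fin d, σ i • y i t = 0) →
      ∀ t ∈ timeInterval T,
        ‖y 0 t‖ ≤ C * ‖fun i : Fin d => y i 0‖ * Real.exp (-r * t) := by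
  obtain ⟨r, C, hr, h⟩ := exists_exponential_bound (companion m σ) fun a ha =>
    hσ a (companion_eigenvalue hd ha)
  refine ⟨r, C, hr, fun T y hT hy hyd t ht => ?_⟩
  -- Complexifying the entries preserves the sup norm, so the complex bound applies to real
  -- solutions.
  have hnorm : ∀ v : Fin d → Fin m → ℝ, ‖fun i j => ((v i j : ℝ) : ℂ)‖ = ‖v‖ := by
    intro v
    simp [Pi.norm_def, Pi.nnnorm_def]
  have := h T (fun t i j => ((y i t j : ℝ) : ℂ)) hT (fun t ht => ?_) t ht
  · rw [hnorm (fun i => y i 0), hnorm (fun i => y i t)] at this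
    exact (norm_le_pi_norm (fun i : Fin d => y i t) ⟨0, hd⟩).trans this
  · rw [hasDerivWithinAt_pi]
    intro i
    rw [hasDerivWithinAt_pi]
    intro j
    have h1 := (hasDerivWithinAt_pi.1 (hy i i.2 t ht) j).ofReal_comp
    refine h1.congr_deriv ?_
    by_cases hi : (i : ℕ) + 1 < d
    · rw [companion_apply_of_lt _ _ hi]
    · rw [companion_apply_of_not_lt _ _ hi]
      have hid : (i : ℕ) + 1 = d := by omega
      have h2 := congrFun (hyd t ht) j
      rw [hid, eq_neg_of_add_eq_zero_left (a := y d t j) (b := (∑ i : Fin d, σ i • y i t) j) h2]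
      simp

end Companion

/-! ### From chains of derivatives to iterated derivatives -/

section Jets

/-- A function with a chain of `d` successive derivatives is `C^d`, with these derivatives. -/
theorem iteratedDerivWithin_eq_of_chain {F : Type*} [NormedAddCommGroup F] [NormedSpace ℝ F]
    {S : Set ℝ} (hS : UniqueDiffOn ℝ S) {d : ℕ} {y : ℕ → ℝ → F}
    (hy : ∀ i < d, ∀ t ∈ S, HasDerivWithinAt (y i) (y (i + 1) t) S t) {i : ℕ} (hi : i ≤ d)
    {t : ℝ} (ht : t ∈ S) : iteratedDerivWithin i (y 0) S t = y i t := by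
  induction i generalizing t with
  | zero => simp
  | succ i ih =>
    rw [iteratedDerivWithin_succ, derivWithin_congr (fun s hs => ih (by omega) hs)
      (ih (by omega) ht)]
    exact (hy i hi t ht).derivWithin (hS t ht)

theorem contDiffOn_of_chain {F : Type*} [NormedAddCommGroup F] [NormedSpace ℝ F]
    {S : Set ℝ} (hS : UniqueDiffOn ℝ S) {d : ℕ} {y : ℕ → ℝ → F}
    (hy : ∀ i < d, ∀ t ∈ S, HasDerivWithinAt (y i) (y (i + 1) t) S t)
    (hd : ContinuousOn (y d) S) : ContDiffOn ℝ (d : WithTop ℕ∞) (y 0) S := by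
  induction d generalizing y with
  | zero => simpa [contDiffOn_zero] using hd
  | succ d ih =>
    have h1 := ih (y := fun i => y (i + 1)) (fun i hi => hy (i + 1) (by omega)) hd
    push_cast
    rw [contDiffOn_succ_iff_derivWithin hS]
    refine ⟨fun t ht => (hy 0 (by omega) t ht).differentiableWithinAt, by simp, ?_⟩
    exact h1.congr fun t ht => (hy 0 (by omega) t ht).derivWithin (hS t ht)

end Jets

end CascadeControl
namespace CascadeControl

/-! ### The closed-loop error equation -/

section ErrorDynamics

variable {n nc m dc : ℕ} {f : (Fin n → ℝ) → (Fin n → ℝ)}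
  {g : (Fin n → ℝ) → Matrix (Fin n) (Fin m) ℝ} {fc : (Fin nc → ℝ) → (Fin nc → ℝ)}
  {gc : (Fin nc → ℝ) → Matrix (Fin nc) (Fin m) ℝ} {hc : (Fin nc → ℝ) → (Fin m → ℝ)}
  {Q : (Fin n → ℝ) → Matrix (Fin m) (Fin m) ℝ} {c : (Fin n → ℝ) → (Fin m → ℝ)}
  {σ : Fin dc → ℝ}

/-- The derivatives of the control error along a trajectory `X`: the `i`-th one for `i < dc`, and
for `i = dc` the value which the error equation prescribes. -/
noncomputable def errorJet (f : (Fin n → ℝ) → (Fin n → ℝ))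
    (g : (Fin n → ℝ) → Matrix (Fin n) (Fin m) ℝ)
    (fc : (Fin nc → ℝ) → (Fin nc → ℝ)) (hc : (Fin nc → ℝ) → (Fin m → ℝ))
    (Q : (Fin n → ℝ) → Matrix (Fin m) (Fin m) ℝ) (c : (Fin n → ℝ) → (Fin m → ℝ))
    (σ : Fin dc → ℝ) (X : ℝ → (Fin n → ℝ) × (Fin nc → ℝ)) (i : ℕ) (t : ℝ) : Fin m → ℝ :=
  if i < dc then
    (lieDeriv fc)^[i] hc (X t).2
      - (lieDeriv (cascadeDrift f g fc hc))^[i] (desiredControl Q c) (X t)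
  else -∑ j : Fin dc, σ j • ((lieDeriv fc)^[(j : ℕ)] hc (X t).2
      - (lieDeriv (cascadeDrift f g fc hc))^[(j : ℕ)] (desiredControl Q c) (X t))

theorem errorJet_of_lt {X : ℝ → (Fin n → ℝ) × (Fin nc → ℝ)} {i : ℕ} (hi : i < dc) (t : ℝ) :
    errorJet f g fc hc Q c σ X i t = (lieDeriv fc)^[i] hc (X t).2
      - (lieDeriv (cascadeDrift f g fc hc))^[i] (desiredControl Q c) (X t) :=
  if_pos hi

theorem errorJet_zero (hd : 0 < dc) (X : ℝ → (Fin n → ℝ) × (Fin nc → ℝ)) :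
    errorJet f g fc hc Q c σ X 0 = controlError hc Q c X :=
  funext fun t => errorJet_of_lt hd t

theorem errorJet_equation (X : ℝ → (Fin n → ℝ) × (Fin nc → ℝ)) (t : ℝ) :
    errorJet f g fc hc Q c σ X dc t
      + ∑ i : Fin dc, σ i • errorJet f g fc hc Q c σ X i t = 0 := by
  have h : ∀ i : Fin dc, errorJet f g fc hc Q c σ X i t = _ := fun i => errorJet_of_lt i.2 t
  simp only [h]
  rw [errorJet, if_neg (lt_irrefl _)]
  exact neg_add_cancel _

theorem lieMat_mulVec_desiredSurrogate (hrel : HasRelDegree fc gc hc dc)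
    (p : (Fin n → ℝ) × (Fin nc → ℝ)) :
    lieMat gc ((lieDeriv fc)^[dc - 1] hc) p.2 *ᵥ desiredSurrogate f g fc gc hc Q c dc σ p
      = (lieDeriv (cascadeDrift f g fc hc))^[dc] (desiredControl Q c) p
          - (lieDeriv fc)^[dc] hc p.2
        + ∑ i : Fin dc, σ i •
            ((lieDeriv (cascadeDrift f g fc hc))^[(i : ℕ)] (desiredControl Q c) p
              - (lieDeriv fc)^[(i : ℕ)] hc p.2) := by
  have hu := (Matrix.isUnit_iff_isUnit_det _).1 (hrel.2.2 p.2)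
  rw [desiredSurrogate, Matrix.mulVec_mulVec, Matrix.mul_nonsing_inv _ hu, Matrix.one_mulVec]

/-- Below the top order no input appears. At the top order the nonsingular matrix times the
surrogate control cancels both `dc`-th Lie derivatives and leaves the prescribed feedback. -/
theorem hasDerivWithinAt_errorJet
    (hfs : ContDiff ℝ ((dc - 1 : ℕ) : WithTop ℕ∞) f)
    (hgs : ∀ i j, ContDiff ℝ ((dc - 1 : ℕ) : WithTop ℕ∞) (fun x => g x i j))
    (hfcs : ContDiff ℝ ((dc - 1 : ℕ) : WithTop ℕ∞) fc)
    (hhcs : ContDiff ℝ (dc : WithTop ℕ∞) hc)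
    (huds : ContDiff ℝ (dc : WithTop ℕ∞) (fun x => -((Q x)⁻¹ *ᵥ c x)))
    (hrel : HasRelDegree fc gc hc dc)
    {x₀ : (Fin n → ℝ) × (Fin nc → ℝ)} {T : EReal} {X : ℝ → (Fin n → ℝ) × (Fin nc → ℝ)}
    (hX : IsCascadeSolution f g fc gc hc (desiredSurrogate f g fc gc hc Q c dc σ) x₀ T X)
    {i : ℕ} (hi : i < dc) {t : ℝ} (ht : t ∈ timeInterval T) :
    HasDerivWithinAt (errorJet f g fc hc Q c σ X i) (errorJet f g fc hc Q c σ X (i + 1) t)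
      (timeInterval T) t := by
  have hXt := hX.2.2 t ht
  set w := desiredSurrogate f g fc gc hc Q c dc σ (X t) with hw
  have h0 : HasDerivWithinAt (fun t => (X t).2) (fc (X t).2 + gc (X t).2 *ᵥ w)
      (timeInterval T) t := by
    have h := (hasFDerivAt_snd (𝕜 := ℝ) (p := X t)).comp_hasDerivWithinAt t hXt
    exact h
  have h1 : HasDerivWithinAt (fun t => (lieDeriv fc)^[i] hc (X t).2)
      (fderiv ℝ ((lieDeriv fc)^[i] hc) (X t).2 (fc (X t).2 + gc (X t).2 *ᵥ w))
      (timeInterval T) t :=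
    (differentiable_iterate_lieDeriv hfcs hhcs hi (X t).2).hasFDerivAt.comp_hasDerivWithinAt t h0
  obtain ⟨h2, h3⟩ := fderiv_iterate_lieDeriv_cascade hfs hgs hfcs hhcs hrel huds hi (X t) w
  have h4 := h2.comp_hasDerivWithinAt t hXt
  rw [h3] at h4
  rw [fderiv_iterate_lieDeriv_output] at h1
  have h5 := h1.sub h4
  have hfun : errorJet f g fc hc Q c σ X i = fun t => (lieDeriv fc)^[i] hc (X t).2
      - (lieDeriv (cascadeDrift f g fc hc))^[i] (desiredControl Q c) (X t) :=
    funext fun t => errorJet_of_lt hi t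
  rw [hfun]
  refine h5.congr_deriv ?_
  change _ - (lieDeriv (cascadeDrift f g fc hc))^[i + 1] (desiredControl Q c) (X t) = _
  by_cases hi' : i + 1 < dc
  · rw [hrel.2.1 _ i (by omega), Matrix.zero_mulVec, add_zero, errorJet_of_lt hi']
  -- Top order: the only place where the formula for the surrogate control is used.
  · obtain rfl : dc = i + 1 := by omega
    have h6 := lieMat_mulVec_desiredSurrogate (f := f) (g := g) (Q := Q) (c := c) (σ := σ) hrel (X t)
    rw [Nat.add_sub_cancel] at h6
    rw [h6, errorJet, if_neg (lt_irrefl _), ← Finset.sum_neg_distrib]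
    have h7 : ∀ j : Fin (i + 1), -(σ j • ((lieDeriv fc)^[(j : ℕ)] hc (X t).2
          - (lieDeriv (cascadeDrift f g fc hc))^[(j : ℕ)] (desiredControl Q c) (X t)))
        = σ j • ((lieDeriv (cascadeDrift f g fc hc))^[(j : ℕ)] (desiredControl Q c) (X t)
          - (lieDeriv fc)^[(j : ℕ)] hc (X t).2) := fun j => by
      rw [← smul_neg, neg_sub]
    simp only [h7]
    abel

/-- The top entry is a combination of the lower ones, so no continuity of the surrogate control is
needed. -/
theorem continuousOn_errorJet {X : ℝ → (Fin n → ℝ) × (Fin nc → ℝ)} {S : Set ℝ}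
    (h : ∀ i < dc, ContinuousOn (errorJet f g fc hc Q c σ X i) S) :
    ContinuousOn (errorJet f g fc hc Q c σ X dc) S := by
  have h1 : errorJet f g fc hc Q c σ X dc
      = (fun t => -∑ i : Fin dc, σ i • errorJet f g fc hc Q c σ X i t) :=
    funext fun t => eq_neg_of_add_eq_zero_left (errorJet_equation X t)
  rw [h1]
  exact (continuousOn_finsetSum _ fun (i : Fin dc) _ => (h i i.2).const_smul (σ i)).neg

end ErrorDynamics

/-! ### The excess cost as a quadratic form -/

section Cost

variable {n m : ℕ}

/-- The excess cost over the minimizer `-Q⁻¹ c` is a quadratic form in the distance to it. -/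
theorem cost_sub_cost {Q : (Fin n → ℝ) → Matrix (Fin m) (Fin m) ℝ} {c : (Fin n → ℝ) → (Fin m → ℝ)}
    {x : Fin n → ℝ} (hQ : (Q x).PosDef) (u : Fin m → ℝ) :
    cost Q c x u - cost Q c x (-((Q x)⁻¹ *ᵥ c x))
      = 1 / 2 * ((u - -((Q x)⁻¹ *ᵥ c x)) ⬝ᵥ (Q x *ᵥ (u - -((Q x)⁻¹ *ᵥ c x)))) := by
  have hdet : IsUnit (Q x).det := (Matrix.isUnit_iff_isUnit_det _).1 hQ.isUnit
  set v := -((Q x)⁻¹ *ᵥ c x) with hv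
  have hc : c x = -(Q x *ᵥ v) := by
    rw [hv, Matrix.mulVec_neg, neg_neg, Matrix.mulVec_mulVec, Matrix.mul_nonsing_inv _ hdet,
      Matrix.one_mulVec]
  clear_value v
  have hsymm : ∀ a b : Fin m → ℝ, a ⬝ᵥ (Q x *ᵥ b) = b ⬝ᵥ (Q x *ᵥ a) := by
    intro a b
    have ht : (Q x)ᵀ = Q x := by
      have := hQ.isHermitian
      rwa [Matrix.IsHermitian, Matrix.conjTranspose_eq_transpose_of_trivial] at this
    rw [Matrix.dotProduct_mulVec, ← Matrix.mulVec_transpose, ht, dotProduct_comm]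
  simp only [cost]
  rw [hc, neg_dotProduct, neg_dotProduct, dotProduct_comm (Q x *ᵥ v) u,
    dotProduct_comm (Q x *ᵥ v) v, Matrix.mulVec_sub, sub_dotProduct, dotProduct_sub,
    dotProduct_sub, hsymm v u]
  ring

theorem abs_dotProduct_mulVec_le {A : Matrix (Fin m) (Fin m) ℝ} {M : ℝ}
    (hM : ∀ i j, |A i j| ≤ M) (v : Fin m → ℝ) :
    |v ⬝ᵥ (A *ᵥ v)| ≤ (m : ℝ) * m * M * (‖v‖ * ‖v‖) := by
  have hv : ∀ i, |v i| ≤ ‖v‖ := fun i => norm_le_pi_norm v i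
  calc |v ⬝ᵥ (A *ᵥ v)| = |∑ i, ∑ j, v i * (A i j * v j)| := by
        simp only [dotProduct, Matrix.mulVec, Finset.mul_sum]
    _ ≤ ∑ i, ∑ j, |v i * (A i j * v j)| :=
        (Finset.abs_sum_le_sum_abs _ _).trans
          (Finset.sum_le_sum fun i _ => Finset.abs_sum_le_sum_abs _ _)
    _ ≤ ∑ _i : Fin m, ∑ _j : Fin m, ‖v‖ * (M * ‖v‖) := by
        refine Finset.sum_le_sum fun i _ => Finset.sum_le_sum fun j _ => ?_
        rw [abs_mul, abs_mul]
        have hM0 : 0 ≤ M := (abs_nonneg _).trans (hM i j)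
        gcongr
        exacts [hv i, hM i j, hv j]
    _ = _ := by
        simp only [Finset.sum_const, Finset.card_univ, Fintype.card_fin, nsmul_eq_mul]
        ring

end Cost

end CascadeControl
-- Assembly of the four claims
theorem mainTheorem7 (n nc m dc : ℕ)
    (f : (Fin n → ℝ) → (Fin n → ℝ)) (g : (Fin n → ℝ) → Matrix (Fin n) (Fin m) ℝ)
    (fc : (Fin nc → ℝ) → (Fin nc → ℝ)) (gc : (Fin nc → ℝ) → Matrix (Fin nc) (Fin m) ℝ)
    (hc : (Fin nc → ℝ) → (Fin m → ℝ))
    (Q : (Fin n → ℝ) → Matrix (Fin m) (Fin m) ℝ) (c : (Fin n → ℝ) → (Fin m → ℝ))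
    (σ : Fin dc → ℝ)
    -- the data are locally Lipschitz
    (hf : LocallyLipschitz f) (hg : ∀ i j, LocallyLipschitz (fun x => g x i j))
    (hfc : LocallyLipschitz fc) (hgc : ∀ i j, LocallyLipschitz (fun xc => gc xc i j))
    (hhc : LocallyLipschitz hc)
    (hQ : ∀ i j, LocallyLipschitz (fun x => Q x i j)) (hcc : LocallyLipschitz c)
    -- `Q` takes values in the symmetric positive definite matrices
    (hQpos : ∀ x, (Q x).PosDef)
    -- smooth enough for the Lie derivatives that occur to exist and be continuous
    (hfs : ContDiff ℝ ((dc - 1 : ℕ) : WithTop ℕ∞) f)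
    (hgs : ∀ i j, ContDiff ℝ ((dc - 1 : ℕ) : WithTop ℕ∞) (fun x => g x i j))
    (hfcs : ContDiff ℝ ((dc - 1 : ℕ) : WithTop ℕ∞) fc)
    (hhcs : ContDiff ℝ (dc : WithTop ℕ∞) hc)
    (huds : ContDiff ℝ (dc : WithTop ℕ∞) (fun x => -((Q x)⁻¹ *ᵥ c x)))
    -- relative degree of the control dynamics
    (hrel : CascadeControl.HasRelDegree fc gc hc dc)
    -- the gains are positive and all roots of `σ(s)` lie in the open left half plane
    (hσpos : ∀ i, 0 < σ i)
    (hσ : ∀ s : ℂ, s ^ dc + ∑ i : Fin dc, (σ i : ℂ) * s ^ (i : ℕ) = 0 → s.re < 0) :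
    -- the error equation
    (∀ (x₀ : (Fin n → ℝ) × (Fin nc → ℝ)) (T : EReal) (X : ℝ → (Fin n → ℝ) × (Fin nc → ℝ)),
      CascadeControl.IsCascadeSolution f g fc gc hc
          (CascadeControl.desiredSurrogate f g fc gc hc Q c dc σ) x₀ T X →
        ContDiffOn ℝ (dc : WithTop ℕ∞) (CascadeControl.controlError hc Q c X)
          (CascadeControl.timeInterval T) ∧
        ∀ t ∈ CascadeControl.timeInterval T,
          iteratedDerivWithin dc (CascadeControl.controlError hc Q c X)
              (CascadeControl.timeInterval T) t
            + ∑ i : Fin dc, σ i •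
                iteratedDerivWithin (i : ℕ) (CascadeControl.controlError hc Q c X)
                  (CascadeControl.timeInterval T) t = 0) ∧
    -- exponential convergence of the error
    (∃ r : ℝ, 0 < r ∧
      ∀ (x₀ : (Fin n → ℝ) × (Fin nc → ℝ)) (T : EReal) (X : ℝ → (Fin n → ℝ) × (Fin nc → ℝ)),
        CascadeControl.IsCascadeSolution f g fc gc hc
            (CascadeControl.desiredSurrogate f g fc gc hc Q c dc σ) x₀ T X →
          (∃ K : ℝ, ∀ t ∈ CascadeControl.timeInterval T,
            ‖CascadeControl.controlError hc Q c X t‖ ≤ K * Real.exp (-r * t)) ∧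
          (T = ⊤ →
            Filter.Tendsto (CascadeControl.controlError hc Q c X) Filter.atTop (𝓝 0))) ∧
    -- convergence of the cost, for bounded `Q`
    ((∃ M : ℝ, ∀ x i j, |Q x i j| ≤ M) →
      ∀ (x₀ : (Fin n → ℝ) × (Fin nc → ℝ)) (X : ℝ → (Fin n → ℝ) × (Fin nc → ℝ)),
        CascadeControl.IsCascadeSolution f g fc gc hc
            (CascadeControl.desiredSurrogate f g fc gc hc Q c dc σ) x₀ ⊤ X →
          Filter.Tendsto
            (fun t => CascadeControl.cost Q c (X t).1 (hc (X t).2)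
              - CascadeControl.cost Q c (X t).1 (CascadeControl.desiredControl Q c (X t)))
            Filter.atTop (𝓝 0)) ∧
    -- identity of the controls for matching initial data
    (∀ (x₀ : (Fin n → ℝ) × (Fin nc → ℝ)) (T : EReal) (X : ℝ → (Fin n → ℝ) × (Fin nc → ℝ)),
      CascadeControl.IsCascadeSolution f g fc gc hc
          (CascadeControl.desiredSurrogate f g fc gc hc Q c dc σ) x₀ T X →
        (∀ i : ℕ, i < dc →
          (CascadeControl.lieDeriv fc)^[i] hc x₀.2 =
            (CascadeControl.lieDeriv (CascadeControl.cascadeDrift f g fc hc))^[i]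
              (CascadeControl.desiredControl Q c) x₀) →
        ∀ t ∈ CascadeControl.timeInterval T,
          hc (X t).2 = CascadeControl.desiredControl Q c (X t)) := by
  have hd : 0 < dc := hrel.1
  have hjet := fun (x₀ : (Fin n → ℝ) × (Fin nc → ℝ)) (T : EReal)
      (X : ℝ → (Fin n → ℝ) × (Fin nc → ℝ)) (hX : CascadeControl.IsCascadeSolution f g fc gc hc
        (CascadeControl.desiredSurrogate f g fc gc hc Q c dc σ) x₀ T X) (i : ℕ) (hi : i < dc)
      (t : ℝ) (ht : t ∈ CascadeControl.timeInterval T) =>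
    CascadeControl.hasDerivWithinAt_errorJet hfs hgs hfcs hhcs huds hrel hX hi ht
  obtain ⟨r, C, hr, hdecay⟩ := CascadeControl.exists_exponential_bound_of_hurwitz m hd hσ
  -- `r` and `C` are fixed before the solution; only the initial jet varies. Claims (b), (c) and (d)
  -- all rest on this bound.
  have hbound := fun x₀ T X hX => hdecay T (CascadeControl.errorJet f g fc hc Q c σ X) hX.1
    (hjet x₀ T X hX) fun t _ => CascadeControl.errorJet_equation X t
  simp only [CascadeControl.errorJet_zero hd] at hbound
  have hlim : ∀ (x₀ : (Fin n → ℝ) × (Fin nc → ℝ)) (X : ℝ → (Fin n → ℝ) × (Fin nc → ℝ)),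
      CascadeControl.IsCascadeSolution f g fc gc hc
          (CascadeControl.desiredSurrogate f g fc gc hc Q c dc σ) x₀ ⊤ X →
        Filter.Tendsto (CascadeControl.controlError hc Q c X) Filter.atTop (𝓝 0) := by
    intro x₀ X hX
    set K := C * ‖fun i : Fin dc => CascadeControl.errorJet f g fc hc Q c σ X i 0‖
    have h1 : Filter.Tendsto (fun t : ℝ => K * Real.exp (-r * t)) Filter.atTop (𝓝 0) := by
      have h2 : Filter.Tendsto (fun t : ℝ => -r * t) Filter.atTop Filter.atBot :=
        Filter.tendsto_id.const_mul_atTop_of_neg (neg_neg_of_pos hr)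
      simpa using (Real.tendsto_exp_atBot.comp h2).const_mul K
    refine squeeze_zero_norm' ?_ h1
    filter_upwards [Filter.eventually_ge_atTop (0 : ℝ)] with t ht
    exact hbound x₀ ⊤ X hX t ⟨ht, EReal.coe_lt_top t⟩
  refine ⟨fun x₀ T X hX => ?_, ⟨r, hr, fun x₀ T X hX => ⟨⟨_, hbound x₀ T X hX⟩, ?_⟩⟩,
    fun hM x₀ X hX => ?_, fun x₀ T X hX h0 t ht => ?_⟩
  · have hS := CascadeControl.uniqueDiffOn_timeInterval hX.1
    have hX' := hjet x₀ T X hX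
    rw [← CascadeControl.errorJet_zero (f := f) (g := g) (fc := fc) (σ := σ) hd X]
    refine ⟨CascadeControl.contDiffOn_of_chain hS hX'
      (CascadeControl.continuousOn_errorJet fun i hi t ht => (hX' i hi t ht).continuousWithinAt),
      fun t ht => ?_⟩
    have hiter := fun (i : ℕ) (hi : i ≤ dc) =>
      CascadeControl.iteratedDerivWithin_eq_of_chain hS hX' hi ht
    rw [hiter dc le_rfl, Finset.sum_congr rfl fun i _ => by rw [hiter i i.2.le]]
    exact CascadeControl.errorJet_equation X t
  · rintro rfl
    exact hlim x₀ X hX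
  · obtain ⟨M, hM⟩ := hM
    have he := (hlim x₀ X hX).norm
    -- The majorant `(1/2) m² M ‖e‖²` of the excess cost, written in the shape the entrywise bound
    -- on `Q` produces.
    have h1 := ((he.mul he).const_mul ((m : ℝ) * m * M)).const_mul (1 / 2 : ℝ)
    simp only [norm_zero, mul_zero] at h1
    refine squeeze_zero_norm (fun t => ?_) h1
    have h2 := CascadeControl.cost_sub_cost (c := c) (hQpos (X t).1) (hc (X t).2)
    have h3 := CascadeControl.abs_dotProduct_mulVec_le (hM (X t).1)
      (CascadeControl.controlError hc Q c X t)
    change |CascadeControl.cost Q c (X t).1 (hc (X t).2)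
      - CascadeControl.cost Q c (X t).1 (-((Q (X t).1)⁻¹ *ᵥ c (X t).1))| ≤ _
    rw [h2, abs_mul, abs_of_pos (by norm_num : (0 : ℝ) < 1 / 2)]
    gcongr
    exact h3
  -- Matching initial data kill the whole initial jet, so the bound is zero at all times; no
  -- uniqueness theorem for the cascade is needed.
  · have hzero : (fun i : Fin dc => CascadeControl.errorJet f g fc hc Q c σ X i 0) = 0 := by
      funext i
      rw [CascadeControl.errorJet_of_lt i.2, hX.2.1, h0 i i.2, sub_self, Pi.zero_apply]
    have h1 := hbound x₀ T X hX t ht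
    rw [hzero, norm_zero, mul_zero, zero_mul] at h1
    exact sub_eq_zero.1 (norm_le_zero_iff.1 h1)
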